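/- There is a universal constant $C>0$ such that the following holds for all periods $L_x,L_y>0$ and every Rayleigh number $\mathrm{Ra}\ge 1$. Let $T$, $\mathbf u=(u^x,u^y,u^z)$ and $p$ be a temperature, velocity and pressure on the layer $\{(x,y,z): 0\le z\le 1\}$, periodic in $x$ and $y$ with periods $L_x$ and $L_y$, that solve the Rayleigh–Bénard system at infinite Prandtl number $$\partial_t T+\mathbf u\cdot\nabla T-\Delta T=0,\qquad \nabla\cdot\mathbf u=0,\qquad \nabla p-\Delta\mathbf u=\mathrm{Ra}\,T\,\mathbf e_z\qquad (t>0,\ 0<z<1)$$ with $T=1$ at $z=0$, $T=0$ at $z=1$, and the no-slip boundary conditions $\mathbf u=0$ at $z\in\{0,1\}$. The solution is classical for $t>0$: $T$ and $\mathbf u$ and their spatial derivatives up to second order, as well as $\partial_tT$, are continuous on $(0,\infty)\times\{0\le z\le1\}$, and $p(\cdot,t)$ is $C^1$ up to the walls for each $t>0$. The initial temperature $T(\cdot,0)$ is square integrable on the period cell $[0,L_x]\times[0,L_y]\times[0,1]$, and $T(\cdot,t)\to T(\cdot,0)$ in $L^2$ of the cell as $t\to0^+$. Then the vertical heat flux $u^zT-\partial_zT$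 is integrable on $(0,t)\times[0,L_x]\times[0,L_y]\times[0,1]$ for every $t>0$, and the Nusselt number $$\mathrm{Nu}=\limsup_{t\to\infty}\frac1t\int_0^t\frac1{L_xL_y}\int_0^{L_x}\!\!\int_0^{L_y}\!\!\int_0^1\big(u^zT-\partial_zT\big)\,dz\,dy\,dx\,ds$$ satisfies $$\mathrm{Nu}\le C\,\mathrm{Ra}^{1/2}.$$ -/

import Mathlib

open MeasureTheory Filter Set Topology

noncomputable section

namespace RayleighBenard

/-- Points of physical space, with coordinates `x 0 = x`, `x 1 = y` (horizontal) and `x 2 = z`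
(vertical). -/
abbrev Space : Type := Fin 3 → ℝ

/-- The closed horizontal layer `ℝ × ℝ × [0,1]` occupied by the fluid. -/
def slab : Set Space := {x | x 2 ∈ Icc (0 : ℝ) 1}

/-- One period cell `Ω = [0,Lx] × [0,Ly] × [0,1]` of the layer. -/
def cell (Lx Ly : ℝ) : Set Space := Icc 0 ![Lx, Ly, 1]

/-- The partial derivative `∂ᵢ f`. It is the ordinary one inside the layer; on the walls
`z = 0, 1` the derivative in `z` is one-sided. -/
def pd (i : Fin 3) (f : Space → ℝ) (x : Space) : ℝ :=
  fderivWithin ℝ f slab x (Pi.single i 1)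

/-- The Laplacian `Δ f = ∂₀∂₀ f + ∂₁∂₁ f + ∂₂∂₂ f`. -/
def lap (f : Space → ℝ) (x : Space) : ℝ := ∑ i, pd i (pd i f) x

/-- Periodicity in the horizontal variables `x`, `y`, with periods `Lx`, `Ly`. -/
def HorizPeriodic {β : Type} (Lx Ly : ℝ) (f : Space → β) : Prop :=
  ∀ x, f (x + Pi.single 0 Lx) = f x ∧ f (x + Pi.single 1 Ly) = f x

/-- `f(t, ·)` is `C²` up to the walls at each time `t > 0`, and `f` with its spatial derivatives
of order at most two is jointly continuous in `(t, x)`, for `t > 0` and `x` in the closed layer. -/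
structure SpatialC2 (f : ℝ → Space → ℝ) : Prop where
  contDiffOn : ∀ t, 0 < t → ContDiffOn ℝ 2 (f t) slab
  continuousOn : ContinuousOn (fun q : ℝ × Space => f q.1 q.2) (Ioi 0 ×ˢ slab)
  continuousOn_pd : ∀ i,
    ContinuousOn (fun q : ℝ × Space => pd i (f q.1) q.2) (Ioi 0 ×ˢ slab)
  continuousOn_pd_pd : ∀ i j,
    ContinuousOn (fun q : ℝ × Space => pd i (pd j (f q.1)) q.2) (Ioi 0 ×ˢ slab)

/-- `∂ₜ f` exists and is jointly continuous for `t > 0` and `x` in the closed layer. -/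
structure TimeC1 (f : ℝ → Space → ℝ) : Prop where
  differentiableAt : ∀ t, 0 < t → ∀ x ∈ slab, DifferentiableAt ℝ (fun s => f s x) t
  continuousOn_deriv :
    ContinuousOn (fun q : ℝ × Space => deriv (fun s => f s q.2) q.1) (Ioi 0 ×ˢ slab)

/-- `(T, u, p)` is a solution, for all times `t > 0`, of the Rayleigh–Bénard system at infinite
Prandtl number with Rayleigh number `Ra`, in the layer `0 ≤ z ≤ 1`, horizontally periodic with
periods `Lx`, `Ly`, with no-slip walls, temperature `1` at the bottom and `0` at the top.
It is classical for `t > 0`, and `T 0` is the initial temperature: a square integrable function,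
attained in `L²` as `t → 0⁺`. -/
structure IsNoSlipSolution (Lx Ly Ra : ℝ) (T : ℝ → Space → ℝ) (u : ℝ → Space → Fin 3 → ℝ)
    (p : ℝ → Space → ℝ) : Prop where
  /- regularity -/
  temp_spatialC2 : SpatialC2 T
  temp_timeC1 : TimeC1 T
  vel_spatialC2 : ∀ i, SpatialC2 (fun t x => u t x i)
  pressure_contDiffOn : ∀ t, 0 < t → ContDiffOn ℝ 1 (p t) slab
  /- horizontal periodicity -/
  temp_periodic : ∀ t, 0 < t → HorizPeriodic Lx Ly (T t)
  vel_periodic : ∀ t, 0 < t → HorizPeriodic Lx Ly (u t)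
  pressure_periodic : ∀ t, 0 < t → HorizPeriodic Lx Ly (p t)
  /- `∂ₜ T + u · ∇T - ΔT = 0` -/
  heat : ∀ t, 0 < t → ∀ x, x 2 ∈ Ioo (0 : ℝ) 1 →
    deriv (fun s => T s x) t + ∑ i, u t x i * pd i (T t) x - lap (T t) x = 0
  /- `∇ · u = 0` -/
  incompressible : ∀ t, 0 < t → ∀ x, x 2 ∈ Ioo (0 : ℝ) 1 →
    ∑ i, pd i (fun y => u t y i) x = 0
  /- `∇p - Δu = Ra T e_z` -/
  stokes : ∀ t, 0 < t → ∀ x, x 2 ∈ Ioo (0 : ℝ) 1 → ∀ i,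
    pd i (p t) x - lap (fun y => u t y i) x = Ra * T t x * (Pi.single 2 1 : Fin 3 → ℝ) i
  /- boundary conditions -/
  no_slip : ∀ t, 0 < t → ∀ x, x 2 = 0 ∨ x 2 = 1 → u t x = 0
  temp_bottom : ∀ t, 0 < t → ∀ x, x 2 = 0 → T t x = 1
  temp_top : ∀ t, 0 < t → ∀ x, x 2 = 1 → T t x = 0
  /- initial temperature -/
  initial_memLp : MemLp (T 0) 2 (volume.restrict (cell Lx Ly))
  initial_tendsto :
    Tendsto (fun t => eLpNorm (T t - T 0) 2 (volume.restrict (cell Lx Ly))) (𝓝[>] 0) (𝓝 0)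

/-- The vertical heat flux `(u T - ∇T) · e_z`. -/
def heatFlux (T : ℝ → Space → ℝ) (u : ℝ → Space → Fin 3 → ℝ) (t : ℝ) (x : Space) : ℝ :=
  u t x 2 * T t x - pd 2 (T t) x

/-- The average over the times `0 ≤ s ≤ t` and the horizontal variables of
`∫₀¹ (u T - ∇T) · e_z dz`. -/
def meanHeatFlux (Lx Ly : ℝ) (T : ℝ → Space → ℝ) (u : ℝ → Space → Fin 3 → ℝ) (t : ℝ) : ℝ :=
  1 / t * ∫ s in (0 : ℝ)..t, 1 / (Lx * Ly) * ∫ x in cell Lx Ly, heatFlux T u s x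

/-- The Nusselt number `Nu = ⟨∫₀¹ (u T - ∇T) · e_z dz⟩`, where `⟨·⟩` is the upper limit as
`t → ∞` of the averages above. It is taken in the extended reals, where it always exists. -/
def nusselt (Lx Ly : ℝ) (T : ℝ → Space → ℝ) (u : ℝ → Space → Fin 3 → ℝ) : EReal :=
  limsup (fun t : ℝ => (meanHeatFlux Lx Ly T u t : EReal)) atTop

end RayleighBenard

end

namespace RayleighBenard

/-! ### Calculus in the layer -/

/-! The proof is a background-method energy argument that uses no maximum principle for `T`. Write A
= Lx Ly, n = m + 1, φ = (1 - z)^n, w = -φ' = n (1 - z)^m, B = ∫ u^z T and S = ∫ (∂_z T)² over the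
cell.

Test the heat equation with 3T - ψ, where ψ = 4φ - (1 - z), so that the test function vanishes on
both walls. The energy ∫ (3/2 T² - ψT) then has time derivative ∫ (-3|∇T|² + ψ' ∂_z T - ψ' u^z T)
(`integral_test_eq`). The part -(1 - z) of ψ contributes -B, a dissipative term: testing the Stokes
equation with u gives ∫ (∂_z u^z)² ≤ Ra B (`integral_pd_vel_sq_le`). The boundary layer part
contributes the dangerous term 4 ∫ w u^z T. Here T may be replaced by θ = T - φ, because u^z has
zero mean at each height. Both θ and u^z vanish on the walls, so `hardy_bottom` gives ∫ w f² ≤ (4/n)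
∫ (∂_z f)² for each. Young's inequality bounds the dangerous term by S + ∫ w² + (128 Ra/n²) B, which
can be absorbed once n² ≥ 256 Ra. As ∫ w² ≤ nA, what remains is dE/dt + B/2 + S ≤ 5nA
(`integral_test_le`).

The energy is bounded below, and above near t = 0 by the L² initial data, so the time integral of
B/2 + S up to t is at most K + 5nAt. The flux integrates to B + A over the cell, whence Nu ≤ 1 + 10n
with n of order Ra^(1/2). -/

lemma interior_layer_subset : {x : Space | x 2 ∈ Ioo (0 : ℝ) 1} ⊆ interior slab :=
  interior_maximal (fun _ hx => ⟨hx.1.le, hx.2.le⟩)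
    (isOpen_Ioo.preimage (continuous_apply (2 : Fin 3)))

lemma slab_mem_nhds {x : Space} (hx : x 2 ∈ Ioo (0 : ℝ) 1) : slab ∈ 𝓝 x :=
  mem_interior_iff_mem_nhds.1 (interior_layer_subset hx)

lemma uniqueDiffOn_slab : UniqueDiffOn ℝ slab := by
  refine uniqueDiffOn_convex ?_ ⟨fun _ => 1 / 2, interior_layer_subset (by norm_num)⟩
  exact (convex_Icc (0 : ℝ) 1).linear_preimage 
    (LinearMap.proj (R := ℝ) (φ := fun _ : Fin 3 => ℝ) 2)

lemma cell_subset_slab (Lx Ly : ℝ) : cell Lx Ly ⊆ slab := fun x hx => by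
  have h0 := hx.1 2
  have h1 := hx.2 2
  exact ⟨by simpa using h0, by simpa using h1⟩

lemma isCompact_cell (Lx Ly : ℝ) : IsCompact (cell Lx Ly) := isCompact_Icc

lemma measurableSet_cell (Lx Ly : ℝ) : MeasurableSet (cell Lx Ly) := measurableSet_Icc

lemma integrableOn_cell {f : Space → ℝ} (hf : ContinuousOn f slab) (Lx Ly : ℝ) :
    IntegrableOn f (cell Lx Ly) :=
  (hf.mono (cell_subset_slab Lx Ly)).integrableOn_compact (isCompact_cell Lx Ly)

/-- The equations hold only for 0 < z < 1; integrals do not see the walls, which form a null set. -/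
lemma ae_cell_interior (Lx Ly : ℝ) :
    ∀ᵐ x ∂volume.restrict (cell Lx Ly), x 2 ∈ Ioo (0 : ℝ) 1 := by
  rw [cell, volume_pi, ← Measure.restrict_congr_set
    (Measure.univ_pi_Ioo_ae_eq_Icc (μ := fun _ : Fin 3 => (volume : Measure ℝ)))]
  refine (ae_restrict_iff' (MeasurableSet.univ_pi fun _ => measurableSet_Ioo)).2
    (ae_of_all _ fun x hx => ?_)
  simpa using hx 2 (mem_univ _)

lemma cell_integral_congr {Lx Ly : ℝ} {f g : Space → ℝ}
    (h : ∀ x, x 2 ∈ Ioo (0 : ℝ) 1 → f x = g x) :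
    ∫ x in cell Lx Ly, f x = ∫ x in cell Lx Ly, g x :=
  integral_congr_ae ((ae_cell_interior Lx Ly).mono h)

lemma cell_integral_mono {Lx Ly : ℝ} {f g : Space → ℝ} (hf : ContinuousOn f slab)
    (hg : ContinuousOn g slab) (h : ∀ x ∈ slab, f x ≤ g x) :
    ∫ x in cell Lx Ly, f x ≤ ∫ x in cell Lx Ly, g x :=
  setIntegral_mono_on (integrableOn_cell hf Lx Ly) (integrableOn_cell hg Lx Ly)
    (measurableSet_cell Lx Ly) fun x hx => h x (cell_subset_slab Lx Ly hx)

lemma cell_integral_const {Lx Ly : ℝ} (hx : 0 < Lx) (hy : 0 < Ly) (c : ℝ) :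
    ∫ _x in cell Lx Ly, c = Lx * Ly * c := by
  have hle : (0 : Space) ≤ ![Lx, Ly, 1] := by
    intro i; fin_cases i <;> simp [hx.le, hy.le]
  rw [setIntegral_const, measureReal_def, cell, Real.volume_Icc_pi_toReal hle]
  simp [Fin.prod_univ_three]

lemma differentiableOn_of_contDiffOn {f : Space → ℝ} (hf : ContDiffOn ℝ 1 f slab) {x : Space}
    (hx : x ∈ slab) : DifferentiableWithinAt ℝ f slab x :=
  hf.differentiableOn one_ne_zero x hx

lemma pd_contDiffOn {f : Space → ℝ} (hf : ContDiffOn ℝ 2 f slab) (i : Fin 3) :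
    ContDiffOn ℝ 1 (pd i f) slab :=
  (hf.fderivWithin uniqueDiffOn_slab (by norm_num)).clm_apply contDiffOn_const

lemma pd_continuousOn {f : Space → ℝ} (hf : ContDiffOn ℝ 1 f slab) (i : Fin 3) :
    ContinuousOn (pd i f) slab :=
  (hf.continuousOn_fderivWithin uniqueDiffOn_slab le_rfl).clm_apply continuousOn_const

lemma pd_mul {f g : Space → ℝ} (hf : ContDiffOn ℝ 1 f slab) (hg : ContDiffOn ℝ 1 g slab)
    (i : Fin 3) {x : Space} (hx : x ∈ slab) :
    pd i (fun y => f y * g y) x = f x * pd i g x + pd i f x * g x := by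
  rw [pd, fderivWithin_fun_mul (uniqueDiffOn_slab x hx) (differentiableOn_of_contDiffOn hf hx)
    (differentiableOn_of_contDiffOn hg hx)]
  simp [pd, mul_comm]

lemma pd_add {f g : Space → ℝ} (hf : ContDiffOn ℝ 1 f slab) (hg : ContDiffOn ℝ 1 g slab)
    (i : Fin 3) {x : Space} (hx : x ∈ slab) :
    pd i (fun y => f y + g y) x = pd i f x + pd i g x := by
  rw [pd, fderivWithin_fun_add (uniqueDiffOn_slab x hx) (differentiableOn_of_contDiffOn hf hx)
    (differentiableOn_of_contDiffOn hg hx)]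
  simp [pd]

lemma pd_sub {f g : Space → ℝ} (hf : ContDiffOn ℝ 1 f slab) (hg : ContDiffOn ℝ 1 g slab)
    (i : Fin 3) {x : Space} (hx : x ∈ slab) :
    pd i (fun y => f y - g y) x = pd i f x - pd i g x := by
  rw [pd, fderivWithin_fun_sub (uniqueDiffOn_slab x hx) (differentiableOn_of_contDiffOn hf hx)
    (differentiableOn_of_contDiffOn hg hx)]
  simp [pd]

lemma pd_const (i : Fin 3) (c : ℝ) (x : Space) : pd i (fun _ => c) x = 0 := by
  simp [pd]

lemma pd_height {g : ℝ → ℝ} {g' : ℝ} (i : Fin 3) {x : Space} (hx : x ∈ slab)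
    (hg : HasDerivAt g g' (x 2)) :
    pd i (fun y => g (y 2)) x = (Pi.single 2 g' : Fin 3 → ℝ) i := by
  have h2 : HasFDerivAt (fun y : Space => y 2)
      (ContinuousLinearMap.proj (R := ℝ) (φ := fun _ : Fin 3 => ℝ) 2) x :=
    (ContinuousLinearMap.proj (R := ℝ) (φ := fun _ : Fin 3 => ℝ) 2).hasFDerivAt
  have h := (hg.comp_hasFDerivAt x h2).hasFDerivWithinAt (s := slab)
  have h3 := h.fderivWithin (uniqueDiffOn_slab x hx)
  rw [pd]
  change fderivWithin ℝ (g ∘ fun y : Space => y 2) slab x (Pi.single i 1) = _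
  rw [h3]
  fin_cases i <;> simp

lemma height_contDiffOn {g : ℝ → ℝ} (hg : ContDiff ℝ 1 g) :
    ContDiffOn ℝ 1 (fun y : Space => g (y 2)) slab :=
  (hg.comp (contDiff_apply ℝ ℝ (2 : Fin 3))).contDiffOn

/-! ### Horizontal periodicity -/

open scoped Pointwise in
lemma vadd_slab {i : Fin 3} (hi : i ≠ 2) (L : ℝ) :
    (Pi.single i L : Space) +ᵥ slab = slab := by
  ext x
  rw [mem_vadd_set_iff_neg_vadd_mem]
  simp [slab, hi.symm]

open scoped Pointwise in
lemma pd_periodic {Lx Ly : ℝ} {f : Space → ℝ} (hf : HorizPeriodic Lx Ly f) (i : Fin 3) :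
    HorizPeriodic Lx Ly (pd i f) := by
  intro x
  have h0 := fderivWithin_comp_add_right (𝕜 := ℝ) (f := f) (x := x) (s := slab)
    (Pi.single 0 Lx : Space)
  have h1 := fderivWithin_comp_add_right (𝕜 := ℝ) (f := f) (x := x) (s := slab)
    (Pi.single 1 Ly : Space)
  rw [vadd_slab (by decide), funext fun y => (hf y).1] at h0
  rw [vadd_slab (by decide), funext fun y => (hf y).2] at h1
  exact ⟨by rw [pd, ← h0, pd], by rw [pd, ← h1, pd]⟩

lemma height_periodic (Lx Ly : ℝ) (g : ℝ → ℝ) :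
    HorizPeriodic Lx Ly (fun x : Space => g (x 2)) := by
  intro x; simp

/-! ### The divergence theorem in a period cell -/

/-- Lateral faces cancel in pairs by periodicity, and the flux through the walls is `V 2`, which
vanishes there. In the open box `fderivWithin` on the slab is the ordinary derivative. -/
theorem integral_div_eq_zero {Lx Ly : ℝ} (hLx : 0 < Lx) (hLy : 0 < Ly) {V : Fin 3 → Space → ℝ}
    (hV : ∀ i, ContDiffOn ℝ 1 (V i) slab) (hper : ∀ i, HorizPeriodic Lx Ly (V i))
    (hwall : ∀ x : Space, x 2 = 0 ∨ x 2 = 1 → V 2 x = 0) :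
    ∫ x in cell Lx Ly, ∑ i, pd i (V i) x = 0 := by
  have hle : (0 : Space) ≤ ![Lx, Ly, 1] := by
    intro i; fin_cases i <;> simp [hLx.le, hLy.le]
  have key := integral_divergence_of_hasFDerivAt_off_countable' (0 : Space) ![Lx, Ly, 1] hle V
    (fun i x => fderivWithin ℝ (V i) slab x) ∅ countable_empty
    (fun i => (hV i).continuousOn.mono (cell_subset_slab Lx Ly))
    (fun x hx i => by
      have h2 : x 2 ∈ Ioo (0 : ℝ) 1 := by simpa using hx.1 2 (mem_univ _)
      exact (differentiableOn_of_contDiffOn (hV i)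
        (interior_subset (interior_layer_subset h2))).hasFDerivWithinAt.hasFDerivAt
          (slab_mem_nhds h2))
    (integrableOn_cell (continuousOn_finsetSum _ fun i _ => pd_continuousOn (hV i) i) Lx Ly)
  change ∫ x in Icc (0 : Space) ![Lx, Ly, 1],
    ∑ i, fderivWithin ℝ (V i) slab x (Pi.single i 1) = 0
  rw [key, Fin.sum_univ_three]
  have e0 : ∀ y : Fin 2 → ℝ, V 0 (Fin.insertNth 0 ((![Lx, Ly, 1] : Space) 0) y)
      = V 0 (Fin.insertNth 0 ((0 : Space) 0) y) := by
    intro y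
    rw [← (hper 0 (Fin.insertNth 0 ((0 : Space) 0) y)).1]
    congr 1
    ext j
    refine Fin.succAboveCases 0 ?_ (fun k => ?_) j
    · simp
    · simp
  have e1 : ∀ y : Fin 2 → ℝ, V 1 (Fin.insertNth 1 ((![Lx, Ly, 1] : Space) 1) y)
      = V 1 (Fin.insertNth 1 ((0 : Space) 1) y) := by
    intro y
    rw [← (hper 1 (Fin.insertNth 1 ((0 : Space) 1) y)).2]
    congr 1
    ext j
    refine Fin.succAboveCases 1 ?_ (fun k => ?_) j
    · simp
    · simp
  have e2 : ∀ y : Fin 2 → ℝ, V 2 (Fin.insertNth 2 ((![Lx, Ly, 1] : Space) 2) y) = 0 :=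
    fun y => hwall _ (Or.inr (by simp))
  have e3 : ∀ y : Fin 2 → ℝ, V 2 (Fin.insertNth 2 ((0 : Space) 2) y) = 0 :=
    fun y => hwall _ (Or.inl (by simp))
  simp only [e0, e1, e2, e3]
  simp

/-- A `C¹` periodic function vanishing on both walls has a `z`-derivative of mean zero. -/
theorem integral_pd_two_eq_zero {Lx Ly : ℝ} (hLx : 0 < Lx) (hLy : 0 < Ly) {f : Space → ℝ}
    (hf : ContDiffOn ℝ 1 f slab) (hper : HorizPeriodic Lx Ly f)
    (hwall : ∀ x : Space, x 2 = 0 ∨ x 2 = 1 → f x = 0) :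
    ∫ x in cell Lx Ly, pd 2 f x = 0 := by
  have := integral_div_eq_zero hLx hLy (V := fun i x => if i = 2 then f x else 0)
    (fun i => by by_cases h : i = 2 <;> simp [h, hf, contDiffOn_const])
    (fun i => by
      by_cases h : i = 2
      · simpa [h] using hper
      · intro x; simp [h])
    (fun x hx => by simpa using hwall x hx)
  simpa [Fin.sum_univ_three, pd_const] using this

lemma HorizPeriodic.mul {Lx Ly : ℝ} {f g : Space → ℝ} (hf : HorizPeriodic Lx Ly f)
    (hg : HorizPeriodic Lx Ly g) : HorizPeriodic Lx Ly (fun x => f x * g x) := fun x => by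
  simp only [(hf x).1, (hf x).2, (hg x).1, (hg x).2, and_self]

lemma HorizPeriodic.add {Lx Ly : ℝ} {f g : Space → ℝ} (hf : HorizPeriodic Lx Ly f)
    (hg : HorizPeriodic Lx Ly g) : HorizPeriodic Lx Ly (fun x => f x + g x) := fun x => by
  simp only [(hf x).1, (hf x).2, (hg x).1, (hg x).2, and_self]

lemma HorizPeriodic.sub {Lx Ly : ℝ} {f g : Space → ℝ} (hf : HorizPeriodic Lx Ly f)
    (hg : HorizPeriodic Lx Ly g) : HorizPeriodic Lx Ly (fun x => f x - g x) := fun x => by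
  simp only [(hf x).1, (hf x).2, (hg x).1, (hg x).2, and_self]

lemma cell_integral_add {Lx Ly : ℝ} {f g : Space → ℝ} (hf : ContinuousOn f slab)
    (hg : ContinuousOn g slab) :
    ∫ x in cell Lx Ly, (f x + g x) = (∫ x in cell Lx Ly, f x) + ∫ x in cell Lx Ly, g x :=
  integral_add (integrableOn_cell hf Lx Ly) (integrableOn_cell hg Lx Ly)

lemma cell_integral_sub {Lx Ly : ℝ} {f g : Space → ℝ} (hf : ContinuousOn f slab)
    (hg : ContinuousOn g slab) :
    ∫ x in cell Lx Ly, (f x - g x) = (∫ x in cell Lx Ly, f x) - ∫ x in cell Lx Ly, g x :=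
  integral_sub (integrableOn_cell hf Lx Ly) (integrableOn_cell hg Lx Ly)

/-! ### Weighted inequalities in the vertical variable -/

lemma hasDerivAt_one_sub_pow (m : ℕ) (z : ℝ) :
    HasDerivAt (fun z : ℝ => (1 - z) ^ (m + 1)) (-((m + 1) * (1 - z) ^ m)) z := by
  refine (((hasDerivAt_id z).const_sub 1).fun_pow (m + 1)).congr_deriv ?_
  simp

/-- A Hardy inequality with a weight concentrated at the bottom wall. -/
theorem hardy_bottom {Lx Ly : ℝ} (hLx : 0 < Lx) (hLy : 0 < Ly) {f : Space → ℝ}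
    (hf : ContDiffOn ℝ 1 f slab) (hper : HorizPeriodic Lx Ly f)
    (hwall : ∀ x : Space, x 2 = 0 ∨ x 2 = 1 → f x = 0) (m : ℕ) :
    ∫ x in cell Lx Ly, (m + 1) * (1 - x 2) ^ m * f x ^ 2
      ≤ 4 / (m + 1) * ∫ x in cell Lx Ly, pd 2 f x ^ 2 := by
  have hn : (0 : ℝ) < m + 1 := by positivity
  have hφ : ContDiffOn ℝ 1 (fun y : Space => (1 - y 2) ^ (m + 1)) slab :=
    height_contDiffOn (g := fun z => (1 - z) ^ (m + 1)) (by fun_prop)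
  have h0 := integral_pd_two_eq_zero hLx hLy (hφ.mul (hf.mul hf))
    ((height_periodic Lx Ly fun z => (1 - z) ^ (m + 1)).mul (hper.mul hper))
    (fun x hx => by simp [hwall x hx])
  have hfc := hf.continuousOn
  have hpc := pd_continuousOn hf 2
  have hle : ∫ x in cell Lx Ly, pd 2 (fun y => (1 - y 2) ^ (m + 1) * (f y * f y)) x
      ≤ ∫ x in cell Lx Ly, (2 / (m + 1) * pd 2 f x ^ 2
        - 1 / 2 * ((m + 1) * (1 - x 2) ^ m * f x ^ 2)) := by
    refine cell_integral_mono (pd_continuousOn (hφ.mul (hf.mul hf)) 2) (by fun_prop) fun x hx => ?_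
    rw [pd_mul hφ (hf.mul hf) 2 hx, pd_mul hf hf 2 hx,
      pd_height 2 hx (hasDerivAt_one_sub_pow m (x 2)), Pi.single_eq_same]
    have hr0 : 0 ≤ 1 - x 2 := sub_nonneg.2 hx.2
    have hr1 : 1 - x 2 ≤ 1 := sub_le_self _ hx.1
    have hq0 : 0 ≤ (1 - x 2) ^ m := by positivity
    have hq1 : (1 - x 2) ^ (m + 2) ≤ 1 := pow_le_one₀ hr0 hr1
    -- Young's inequality for the cross term 2 (1 - z)^(m+1) f ∂_z f; the leftover weight (1 -
    -- z)^(m+2) is at most 1.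
    have h1 : 0 ≤ 1 / 2 * (m + 1) * (1 - x 2) ^ m * (f x - 2 * (1 - x 2) * pd 2 f x / (m + 1)) ^ 2 := by
      positivity
    have h2 : 2 / ((m : ℝ) + 1) * pd 2 f x ^ 2 * (1 - x 2) ^ (m + 2)
        ≤ 2 / ((m : ℝ) + 1) * pd 2 f x ^ 2 * 1 := by gcongr
    have h3 : 1 / 2 * (m + 1) * (1 - x 2) ^ m * (f x - 2 * (1 - x 2) * pd 2 f x / (m + 1)) ^ 2
        = 1 / 2 * ((m + 1) * (1 - x 2) ^ m * f x ^ 2)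
          - 2 * (1 - x 2) ^ (m + 1) * f x * pd 2 f x
          + 2 / ((m : ℝ) + 1) * pd 2 f x ^ 2 * (1 - x 2) ^ (m + 2) := by
      field_simp
      ring
    rw [h3] at h1
    linarith
  rw [h0, cell_integral_sub (by fun_prop) (by fun_prop), integral_const_mul,
    integral_const_mul] at hle
  have : 4 / ((m : ℝ) + 1) = 2 * (2 / (m + 1)) := by ring
  rw [this]
  linarith

lemma poincare_vertical {Lx Ly : ℝ} (hLx : 0 < Lx) (hLy : 0 < Ly) {f : Space → ℝ}
    (hf : ContDiffOn ℝ 1 f slab) (hper : HorizPeriodic Lx Ly f)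
    (hwall : ∀ x : Space, x 2 = 0 ∨ x 2 = 1 → f x = 0) :
    ∫ x in cell Lx Ly, f x ^ 2 ≤ 4 * ∫ x in cell Lx Ly, pd 2 f x ^ 2 := by
  simpa using hardy_bottom hLx hLy hf hper hwall 0

/-- The Dirichlet energy of the boundary layer profile `(1 - z) ^ (m + 1)`. -/
lemma integral_profile_deriv_sq_le {Lx Ly : ℝ} (hLx : 0 < Lx) (hLy : 0 < Ly) (m : ℕ) :
    ∫ x in cell Lx Ly, ((m + 1) * (1 - x 2) ^ m) ^ 2 ≤ (m + 1) * (Lx * Ly) := by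
  -- The linear term makes this function vanish on both walls, so its derivative has mean zero. The
  -- integral is then exactly (m+1)²/(2m+1) times the area.
  have hg : ContDiff ℝ 1 (fun z : ℝ => (1 - z) ^ (2 * m + 1) - (1 - z)) := by fun_prop
  have h0 := integral_pd_two_eq_zero hLx hLy (height_contDiffOn hg)
    (height_periodic Lx Ly fun z : ℝ => (1 - z) ^ (2 * m + 1) - (1 - z)) (fun x hx => by rcases hx with h | h <;> simp [h])
  have hA : 0 < Lx * Ly := by positivity
  have h1 : ∫ x in cell Lx Ly, ((m + 1) * (1 - x 2) ^ m) ^ 2 =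
      ∫ x in cell Lx Ly, (((m : ℝ) + 1) ^ 2 / (2 * m + 1) - ((m : ℝ) + 1) ^ 2 / (2 * m + 1) *
        pd 2 (fun y : Space => (1 - y 2) ^ (2 * m + 1) - (1 - y 2)) x) := by
    refine cell_integral_congr fun x hx => ?_
    have hd : HasDerivAt (fun z : ℝ => (1 - z) ^ (2 * m + 1) - (1 - z))
        (-((2 * m + 1) * (1 - x 2) ^ (2 * m)) - (-1)) (x 2) := by
      refine ((hasDerivAt_one_sub_pow (2 * m) (x 2)).fun_sub
        ((hasDerivAt_id (x 2)).const_sub 1)).congr_deriv ?_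
      push_cast
      ring
    rw [pd_height (g := fun z : ℝ => (1 - z) ^ (2 * m + 1) - (1 - z)) 2 ⟨hx.1.le, hx.2.le⟩ hd,
      Pi.single_eq_same]
    field_simp
    ring
  have hc : ContinuousOn
      (pd 2 fun y : Space => (1 - y 2) ^ (2 * m + 1) - (1 - y 2)) slab :=
    pd_continuousOn (height_contDiffOn hg) 2
  rw [h1, cell_integral_sub (by fun_prop) (by fun_prop), integral_const_mul, h0,
    cell_integral_const hLx hLy, mul_zero, sub_zero, mul_comm]
  gcongr
  rw [div_le_iff₀ (by positivity)]
  nlinarith [(Nat.cast_nonneg m : (0 : ℝ) ≤ m)]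

/-! ### Balances at a fixed time -/

/-- The state of a solution at one time; `D` is the time derivative of the temperature. -/
structure Snapshot (Lx Ly Ra : ℝ) (T : Space → ℝ) (u : Fin 3 → Space → ℝ) (p D : Space → ℝ) :
    Prop where
  temp : ContDiffOn ℝ 2 T slab
  vel : ∀ i, ContDiffOn ℝ 2 (u i) slab
  pressure : ContDiffOn ℝ 1 p slab
  deriv_continuousOn : ContinuousOn D slab
  temp_periodic : HorizPeriodic Lx Ly T
  vel_periodic : ∀ i, HorizPeriodic Lx Ly (u i)
  pressure_periodic : HorizPeriodic Lx Ly p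
  heat : ∀ x, x 2 ∈ Ioo (0 : ℝ) 1 → D x + ∑ i, u i x * pd i T x - lap T x = 0
  incompressible : ∀ x, x 2 ∈ Ioo (0 : ℝ) 1 → ∑ i, pd i (u i) x = 0
  stokes : ∀ x, x 2 ∈ Ioo (0 : ℝ) 1 → ∀ i,
    pd i p x - lap (u i) x = Ra * T x * (Pi.single 2 1 : Fin 3 → ℝ) i
  no_slip : ∀ i x, x 2 = 0 ∨ x 2 = 1 → u i x = 0
  temp_bottom : ∀ x, x 2 = 0 → T x = 1
  temp_top : ∀ x, x 2 = 1 → T x = 0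

namespace Snapshot

variable {Lx Ly Ra : ℝ} {T : Space → ℝ} {u : Fin 3 → Space → ℝ} {p D : Space → ℝ}

lemma temp_one (h : Snapshot Lx Ly Ra T u p D) : ContDiffOn ℝ 1 T slab :=
  h.temp.of_le (by norm_num)

lemma vel_one (h : Snapshot Lx Ly Ra T u p D) (i : Fin 3) : ContDiffOn ℝ 1 (u i) slab :=
  (h.vel i).of_le (by norm_num)

lemma temp_continuousOn (h : Snapshot Lx Ly Ra T u p D) : ContinuousOn T slab :=
  h.temp.continuousOn

lemma vel_continuousOn (h : Snapshot Lx Ly Ra T u p D) (i : Fin 3) : ContinuousOn (u i) slab :=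
  (h.vel i).continuousOn

/-- The field G(z) u has divergence u^z g(z) and vanishes on the walls. This expresses that u^z has
zero mean at each height. -/
lemma integral_vel_mul_height (h : Snapshot Lx Ly Ra T u p D) (hLx : 0 < Lx) (hLy : 0 < Ly)
    {G g : ℝ → ℝ} (hG : ContDiff ℝ 1 G) (hg : ∀ z, HasDerivAt G (g z) z) :
    ∫ x in cell Lx Ly, u 2 x * g (x 2) = 0 := by
  rw [← integral_div_eq_zero hLx hLy (V := fun i x => u i x * G (x 2))
    (fun i => (h.vel_one i).mul (height_contDiffOn hG))
    (fun i => (h.vel_periodic i).mul (height_periodic Lx Ly G))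
    (fun x hx => by simp [h.no_slip 2 x hx])]
  refine cell_integral_congr fun x hx => ?_
  have hxs : x ∈ slab := ⟨hx.1.le, hx.2.le⟩
  have hdiv := h.incompressible x hx
  simp only [pd_mul (h.vel_one _) (height_contDiffOn hG) _ hxs, pd_height _ hxs (hg (x 2)),
    Fin.sum_univ_three] at hdiv ⊢
  simp
  linear_combination -G (x 2) * hdiv

lemma integral_pd_temp (h : Snapshot Lx Ly Ra T u p D) (hLx : 0 < Lx) (hLy : 0 < Ly) :
    ∫ x in cell Lx Ly, pd 2 T x = -(Lx * Ly) := by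
  have hφ : ContDiffOn ℝ 1 (fun y : Space => 1 - y 2) slab :=
    height_contDiffOn (g := fun z => 1 - z) (by fun_prop)
  have h0 := integral_pd_two_eq_zero hLx hLy (h.temp_one.sub hφ)
    (h.temp_periodic.sub (height_periodic Lx Ly fun z => 1 - z)) (fun x hx => by
      rcases hx with hx | hx
      · simp [hx, h.temp_bottom x hx]
      · simp [hx, h.temp_top x hx])
  have h1 : ∫ x in cell Lx Ly, pd 2 (fun y => T y - (1 - y 2)) x
      = ∫ x in cell Lx Ly, (pd 2 T x + 1) := by
    refine cell_integral_congr fun x hx => ?_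
    have hxs : x ∈ slab := ⟨hx.1.le, hx.2.le⟩
    rw [pd_sub h.temp_one hφ 2 hxs, pd_height (g := fun z => 1 - z) 2 hxs
      ((hasDerivAt_id (x 2)).const_sub 1)]
    simp
  rw [h0, cell_integral_add (pd_continuousOn h.temp_one 2) continuousOn_const,
    cell_integral_const hLx hLy] at h1
  linarith

/-- The viscous dissipation is controlled by the work of the buoyancy force. -/
theorem integral_pd_vel_sq_le (h : Snapshot Lx Ly Ra T u p D) (hLx : 0 < Lx) (hLy : 0 < Ly) :
    ∫ x in cell Lx Ly, pd 2 (u 2) x ^ 2 ≤ Ra * ∫ x in cell Lx Ly, u 2 x * T x := by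
  have hu := h.vel_one
  have hp := h.pressure
  have hd : ∀ i j, ContDiffOn ℝ 1 (pd j (u i)) slab := fun i j => pd_contDiffOn (h.vel i) j
  have hsum : ∀ j, ContDiffOn ℝ 1 (fun x => u 0 x * pd j (u 0) x + u 1 x * pd j (u 1) x
      + u 2 x * pd j (u 2) x) slab := fun j =>
    (((hu 0).mul (hd 0 j)).add ((hu 1).mul (hd 1 j))).add ((hu 2).mul (hd 2 j))
  -- The field ∇(|u|²/2) - p u vanishes on the walls; by incompressibility and the Stokes equation
  -- its divergence is |∇u|² - Ra u^z T.
  have hV : ∀ j, ContDiffOn ℝ 1 (fun x => u 0 x * pd j (u 0) x + u 1 x * pd j (u 1) x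
      + u 2 x * pd j (u 2) x - p x * u j x) slab := fun j => (hsum j).sub (hp.mul (hu j))
  have hper := h.vel_periodic
  have h0 := integral_div_eq_zero hLx hLy hV
    (fun j => ((((hper 0).mul (pd_periodic (hper 0) j)).add
      ((hper 1).mul (pd_periodic (hper 1) j))).add ((hper 2).mul (pd_periodic (hper 2) j))).sub
        (h.pressure_periodic.mul (hper j)))
    (fun x hx => by simp [h.no_slip _ x hx])
  have h1 : ∫ x in cell Lx Ly, ∑ j, pd j (fun x => u 0 x * pd j (u 0) x + u 1 x * pd j (u 1) x
      + u 2 x * pd j (u 2) x - p x * u j x) x =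
      ∫ x in cell Lx Ly, ((∑ j, ∑ i, pd j (u i) x ^ 2) - Ra * (u 2 x * T x)) := by
    refine cell_integral_congr fun x hx => ?_
    have hxs : x ∈ slab := ⟨hx.1.le, hx.2.le⟩
    have e : ∀ j, pd j (fun x => u 0 x * pd j (u 0) x + u 1 x * pd j (u 1) x
        + u 2 x * pd j (u 2) x - p x * u j x) x =
        (u 0 x * pd j (pd j (u 0)) x + pd j (u 0) x * pd j (u 0) x)
        + (u 1 x * pd j (pd j (u 1)) x + pd j (u 1) x * pd j (u 1) x)
        + (u 2 x * pd j (pd j (u 2)) x + pd j (u 2) x * pd j (u 2) x)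
        - (p x * pd j (u j) x + pd j p x * u j x) := fun j => by
      rw [pd_sub (hsum j) (hp.mul (hu j)) j hxs,
        pd_add (((hu 0).mul (hd 0 j)).add ((hu 1).mul (hd 1 j))) ((hu 2).mul (hd 2 j)) j hxs,
        pd_add ((hu 0).mul (hd 0 j)) ((hu 1).mul (hd 1 j)) j hxs,
        pd_mul (hu 0) (hd 0 j) j hxs, pd_mul (hu 1) (hd 1 j) j hxs,
        pd_mul (hu 2) (hd 2 j) j hxs, pd_mul hp (hu j) j hxs]
    have hdiv := h.incompressible x hx
    have s0 := h.stokes x hx 0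
    have s1 := h.stokes x hx 1
    have s2 := h.stokes x hx 2
    simp only [e, lap, Fin.sum_univ_three] at hdiv s0 s1 s2 ⊢
    simp at s0 s1 s2
    linear_combination -p x * hdiv - u 0 x * s0 - u 1 x * s1 - u 2 x * s2
  have hTc := h.temp_continuousOn
  have huc := h.vel_continuousOn
  have hpc : ∀ i j, ContinuousOn (pd j (u i)) slab := fun i j => (hd i j).continuousOn
  have hsq : ContinuousOn (fun x => ∑ j, ∑ i, pd j (u i) x ^ 2) slab := by fun_prop
  rw [h0, cell_integral_sub hsq (by fun_prop), integral_const_mul] at h1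
  have h2 : ∫ x in cell Lx Ly, pd 2 (u 2) x ^ 2
      ≤ ∫ x in cell Lx Ly, ∑ j, ∑ i, pd j (u i) x ^ 2 := by
    refine cell_integral_mono (by fun_prop) hsq fun x _ => ?_
    simp only [Fin.sum_univ_three]
    nlinarith only [sq_nonneg (pd 0 (u 0) x), sq_nonneg (pd 0 (u 1) x), sq_nonneg (pd 0 (u 2) x),
      sq_nonneg (pd 1 (u 0) x), sq_nonneg (pd 1 (u 1) x), sq_nonneg (pd 1 (u 2) x),
      sq_nonneg (pd 2 (u 0) x), sq_nonneg (pd 2 (u 1) x)]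
  linarith

/-- The balance obtained by testing the heat equation against `3 T - ψ(z)`. -/
theorem integral_test_eq (h : Snapshot Lx Ly Ra T u p D) (hLx : 0 < Lx) (hLy : 0 < Ly)
    {ψ ψ' : ℝ → ℝ} (hψ : ContDiff ℝ 1 ψ) (hψ' : ∀ z, HasDerivAt ψ (ψ' z) z)
    (hψ0 : ψ 0 = 3) (hψ1 : ψ 1 = 0) :
    ∫ x in cell Lx Ly, (3 * T x - ψ (x 2)) * D x =
      ∫ x in cell Lx Ly, (-3 * ∑ i, pd i T x ^ 2 + ψ' (x 2) * pd 2 T x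
        - ψ' (x 2) * (u 2 x * T x)) := by
  have hT := h.temp_one
  have hu := h.vel_one
  have hψc := height_contDiffOn hψ
  have hc : ContDiffOn ℝ 1 (fun _ : Space => (3 : ℝ)) slab := contDiffOn_const
  have hc' : ContDiffOn ℝ 1 (fun _ : Space => (3 / 2 : ℝ)) slab := contDiffOn_const
  have hd : ∀ j, ContDiffOn ℝ 1 (pd j T) slab := fun j => pd_contDiffOn h.temp j
  have hη : ContDiffOn ℝ 1 (fun x => 3 * T x - ψ (x 2)) slab := (hc.mul hT).sub hψc
  have hζ : ContDiffOn ℝ 1 (fun x => 3 / 2 * (T x * T x) - ψ (x 2) * T x) slab :=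
    (hc'.mul (hT.mul hT)).sub (hψc.mul hT)
  have pc : ∀ c : ℝ, HorizPeriodic Lx Ly (fun _ : Space => c) := fun c x => ⟨rfl, rfl⟩
  have pT := h.temp_periodic
  have pψ := height_periodic Lx Ly ψ
  -- The field (3T - ψ)∇T - (3/2 T² - ψT)u has as divergence the difference of the two integrands.
  -- On the walls its first part vanishes by the values of ψ, its second by no slip.
  have h0 := integral_div_eq_zero hLx hLy
    (V := fun j x => (3 * T x - ψ (x 2)) * pd j T x
      - (3 / 2 * (T x * T x) - ψ (x 2) * T x) * u j x)
    (fun j => (hη.mul (hd j)).sub (hζ.mul (hu j)))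
    (fun j => ((((pc 3).mul pT).sub pψ).mul (pd_periodic pT j)).sub
      ((((pc (3 / 2)).mul (pT.mul pT)).sub (pψ.mul pT)).mul (h.vel_periodic j)))
    (fun x hx => by
      rcases hx with hx | hx
      · simp [h.no_slip 2 x (Or.inl hx), h.temp_bottom x hx, hx, hψ0]
      · simp [h.no_slip 2 x (Or.inr hx), h.temp_top x hx, hx, hψ1])
  rw [← sub_eq_zero, ← h0, ← integral_sub (integrableOn_cell _ Lx Ly) (integrableOn_cell _ Lx Ly)]
  · refine cell_integral_congr fun x hx => ?_
    have hxs : x ∈ slab := ⟨hx.1.le, hx.2.le⟩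
    have e : ∀ j, pd j (fun x => (3 * T x - ψ (x 2)) * pd j T x
        - (3 / 2 * (T x * T x) - ψ (x 2) * T x) * u j x) x =
        ((3 * T x - ψ (x 2)) * pd j (pd j T) x
          + (3 * pd j T x - (Pi.single 2 (ψ' (x 2)) : Fin 3 → ℝ) j) * pd j T x)
        - ((3 / 2 * (T x * T x) - ψ (x 2) * T x) * pd j (u j) x
          + (3 / 2 * (T x * pd j T x + pd j T x * T x)
            - (ψ (x 2) * pd j T x + (Pi.single 2 (ψ' (x 2)) : Fin 3 → ℝ) j * T x)) * u j x) :=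
      fun j => by
        rw [pd_sub (hη.mul (hd j)) (hζ.mul (hu j)) j hxs, pd_mul hη (hd j) j hxs,
          pd_mul hζ (hu j) j hxs, pd_sub (hc.mul hT) hψc j hxs, pd_mul hc hT j hxs,
          pd_sub (hc'.mul (hT.mul hT)) (hψc.mul hT) j hxs, pd_mul hc' (hT.mul hT) j hxs,
          pd_mul hT hT j hxs, pd_mul hψc hT j hxs, pd_height j hxs (hψ' (x 2)),
          pd_const, pd_const]
        ring
    have hdiv := h.incompressible x hx
    have hheat := h.heat x hx
    simp only [e, lap, Fin.sum_univ_three] at hdiv hheat ⊢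
    simp
    linear_combination (3 * T x - ψ (x 2)) * hheat
      + (3 / 2 * (T x * T x) - ψ (x 2) * T x) * hdiv
  · exact hη.continuousOn.mul h.deriv_continuousOn
  · have hTc := h.temp_continuousOn
    have huc := h.vel_continuousOn
    have hpc : ∀ j, ContinuousOn (pd j T) slab := fun j => (hd j).continuousOn
    have hψ'c : Continuous ψ' := by
      have : ψ' = deriv ψ := funext fun z => (hψ' z).deriv.symm
      exact this ▸ hψ.continuous_deriv le_rfl
    fun_prop

end Snapshot

/-- The test profile: four times a boundary layer of width `1 / (m + 1)` at the bottom, minus the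
conductive profile. -/
def testProfile (m : ℕ) (z : ℝ) : ℝ := 4 * (1 - z) ^ (m + 1) - (1 - z)

lemma contDiff_testProfile (m : ℕ) : ContDiff ℝ 1 (testProfile m) := by
  unfold testProfile; fun_prop

lemma hasDerivAt_testProfile (m : ℕ) (z : ℝ) :
    HasDerivAt (testProfile m) (1 - 4 * ((m + 1) * (1 - z) ^ m)) z := by
  have := ((hasDerivAt_one_sub_pow m z).const_mul 4).fun_sub ((hasDerivAt_id z).const_sub 1)
  refine this.congr_deriv ?_
  ring

lemma testProfile_sq_le (m : ℕ) {z : ℝ} (hz : z ∈ Icc (0 : ℝ) 1) : testProfile m z ^ 2 ≤ 16 := by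
  have h0 : 0 ≤ 1 - z := sub_nonneg.2 hz.2
  have h1 : 1 - z ≤ 1 := sub_le_self _ hz.1
  have h2 : 0 ≤ (1 - z) ^ (m + 1) := by positivity
  have h3 : (1 - z) ^ (m + 1) ≤ 1 := pow_le_one₀ h0 h1
  unfold testProfile
  nlinarith

/-! ### Background-method inequality and flux estimates at a fixed time -/

namespace Snapshot

variable {Lx Ly Ra : ℝ} {T : Space → ℝ} {u : Fin 3 → Space → ℝ} {p D : Space → ℝ}

lemma integral_buoyancy_nonneg (h : Snapshot Lx Ly Ra T u p D) (hLx : 0 < Lx) (hLy : 0 < Ly)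
    (hRa : 0 < Ra) : 0 ≤ ∫ x in cell Lx Ly, u 2 x * T x := by
  have h1 := h.integral_pd_vel_sq_le hLx hLy
  have h2 : 0 ≤ ∫ x in cell Lx Ly, pd 2 (u 2) x ^ 2 := integral_nonneg fun x => sq_nonneg _
  exact nonneg_of_mul_nonneg_right (h2.trans h1) hRa

/-- The dissipation inequality of the background method. -/
theorem integral_test_le (h : Snapshot Lx Ly Ra T u p D) (hLx : 0 < Lx) (hLy : 0 < Ly)
    {m : ℕ} (hm : 256 * Ra ≤ ((m : ℝ) + 1) ^ 2) (hRa : 0 < Ra) :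
    (∫ x in cell Lx Ly, (3 * T x - testProfile m (x 2)) * D x)
        + ((1 / 2) * (∫ x in cell Lx Ly, u 2 x * T x) + ∫ x in cell Lx Ly, pd 2 T x ^ 2)
      ≤ 5 * (m + 1) * (Lx * Ly) := by
  have hn : (0 : ℝ) < m + 1 := by positivity
  have hT := h.temp_one
  have hφ : ContDiffOn ℝ 1 (fun y : Space => (1 - y 2) ^ (m + 1)) slab :=
    height_contDiffOn (g := fun z => (1 - z) ^ (m + 1)) (by fun_prop)
  have hTc := h.temp_continuousOn
  have huc := h.vel_continuousOn
  have hpc : ∀ j, ContinuousOn (pd j T) slab := fun j => pd_continuousOn hT j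
  have hpu : ContinuousOn (pd 2 (u 2)) slab := pd_continuousOn (h.vel_one 2) 2
  have hψ := contDiff_testProfile m
  have hA : 0 < Lx * Ly := by positivity
  have hB := h.integral_buoyancy_nonneg hLx hLy hRa
  have hE := h.integral_pd_vel_sq_le hLx hLy
  -- the term coupling velocity and temperature fluctuation
  have hθ := hardy_bottom hLx hLy (hT.sub hφ)
    (h.temp_periodic.sub (height_periodic Lx Ly fun z => (1 - z) ^ (m + 1))) (fun x hx => by
      rcases hx with hx | hx
      · simp [hx, h.temp_bottom x hx]
      · simp [hx, h.temp_top x hx]) m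
  have hu := hardy_bottom hLx hLy (h.vel_one 2) (h.vel_periodic 2) (h.no_slip 2) m
  have hw := integral_profile_deriv_sq_le hLx hLy m
  have hθ' : ∫ x in cell Lx Ly, pd 2 (fun y => T y - (1 - y 2) ^ (m + 1)) x ^ 2
      ≤ ∫ x in cell Lx Ly, (2 * pd 2 T x ^ 2 + 2 * ((m + 1) * (1 - x 2) ^ m) ^ 2) := by
    refine cell_integral_mono ((pd_continuousOn (hT.sub hφ) 2).pow 2) (by fun_prop) fun x hx => ?_
    rw [pd_sub hT hφ 2 hx, pd_height 2 hx (hasDerivAt_one_sub_pow m (x 2)), Pi.single_eq_same]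
    nlinarith only [sq_nonneg (pd 2 T x - (m + 1) * (1 - x 2) ^ m)]
  rw [cell_integral_add (by fun_prop) (by fun_prop), integral_const_mul, integral_const_mul] at hθ'
  -- Since `g` = wφ, this allows T to be replaced by T - φ in the coupling term ∫ w u^z T.
  have hG := h.integral_vel_mul_height hLx hLy
    (G := fun z => -(1 / 2) * (1 - z) ^ (2 * m + 1 + 1))
    (g := fun z => (m + 1) * (1 - z) ^ (2 * m + 1)) (by fun_prop) (fun z => by
      refine ((hasDerivAt_one_sub_pow (2 * m + 1) z).const_mul (-(1 / 2))).congr_deriv ?_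
      push_cast
      ring)
  have hTA := h.integral_pd_temp hLx hLy
  rw [h.integral_test_eq hLx hLy hψ (hasDerivAt_testProfile m) (by norm_num [testProfile])
    (by simp [testProfile])]
  have hle : ∫ x in cell Lx Ly, (-3 * ∑ i, pd i T x ^ 2
        + (1 - 4 * ((m + 1) * (1 - x 2) ^ m)) * pd 2 T x
        - (1 - 4 * ((m + 1) * (1 - x 2) ^ m)) * (u 2 x * T x))
      ≤ ∫ x in cell Lx Ly, (-2 * pd 2 T x ^ 2 + 4 * ((m + 1) * (1 - x 2) ^ m) ^ 2 + pd 2 T x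
        - u 2 x * T x + 4 * (u 2 x * ((m + 1) * (1 - x 2) ^ (2 * m + 1)))
        + (m + 1) / 8 * ((m + 1) * (1 - x 2) ^ m * (T x - (1 - x 2) ^ (m + 1)) ^ 2)
        + 32 / (m + 1) * ((m + 1) * (1 - x 2) ^ m * u 2 x ^ 2)) := by
    refine cell_integral_mono (by fun_prop) (by fun_prop) fun x hx => ?_
    have hr0 : 0 ≤ 1 - x 2 := sub_nonneg.2 hx.2
    have hq0 : 0 ≤ (1 - x 2) ^ m := by positivity
    have e1 : (1 - x 2) ^ (2 * m + 1) = (1 - x 2) ^ m * (1 - x 2) ^ (m + 1) := by ring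
    -- Young's inequality for 4 w u^z θ. The ratio 16/(m+1) is chosen so that, after `hardy_bottom`,
    -- the θ term costs 1/2 ∫ (∂_z θ)² and the velocity term 128/(m+1)² ∫ (∂_z u^z)².
    have h1 : 0 ≤ 2 * ((m + 1) * (1 - x 2) ^ m) * ((m + 1) / 16)
        * ((T x - (1 - x 2) ^ (m + 1)) - 16 / (m + 1) * u 2 x) ^ 2 := by positivity
    have h3 : 2 * ((m + 1) * (1 - x 2) ^ m) * ((m + 1) / 16)
        * ((T x - (1 - x 2) ^ (m + 1)) - 16 / (m + 1) * u 2 x) ^ 2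
        = (m + 1) / 8 * ((m + 1) * (1 - x 2) ^ m * (T x - (1 - x 2) ^ (m + 1)) ^ 2)
        + 32 / (m + 1) * ((m + 1) * (1 - x 2) ^ m * u 2 x ^ 2)
        - 4 * ((m + 1) * (1 - x 2) ^ m) * (u 2 x * (T x - (1 - x 2) ^ (m + 1))) := by
      field_simp
      ring
    rw [h3] at h1
    rw [e1]
    simp only [Fin.sum_univ_three]
    nlinarith only [sq_nonneg (pd 0 T x), sq_nonneg (pd 1 T x),
      sq_nonneg (pd 2 T x + 2 * ((m + 1) * (1 - x 2) ^ m)), h1]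
  -- The left integral is made opaque so that the additivity rewrites below split only the right
  -- one.
  generalize (∫ x in cell Lx Ly, (-3 * ∑ i, pd i T x ^ 2
        + (1 - 4 * ((m + 1) * (1 - x 2) ^ m)) * pd 2 T x
        - (1 - 4 * ((m + 1) * (1 - x 2) ^ m)) * (u 2 x * T x))) = X at hle ⊢
  rw [cell_integral_add (by fun_prop) (by fun_prop), cell_integral_add (by fun_prop) (by fun_prop),
    cell_integral_add (by fun_prop) (by fun_prop), cell_integral_sub (by fun_prop) (by fun_prop),
    cell_integral_add (by fun_prop) (by fun_prop), cell_integral_add (by fun_prop) (by fun_prop),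
    integral_const_mul, integral_const_mul, integral_const_mul, integral_const_mul,
    integral_const_mul, hG, hTA] at hle
  have k1 := mul_le_mul_of_nonneg_left (hθ.trans (mul_le_mul_of_nonneg_left hθ' (by positivity)))
    (by positivity : 0 ≤ ((m : ℝ) + 1) / 8)
  have k2 := mul_le_mul_of_nonneg_left (hu.trans (mul_le_mul_of_nonneg_left hE (by positivity)))
    (by positivity : 0 ≤ 32 / ((m : ℝ) + 1))
  -- The hypothesis (m+1)² ≥ 256 Ra is spent here: half of the buoyancy work absorbs the velocity
  -- term.
  have k3 : 32 / ((m : ℝ) + 1) * (4 / (m + 1) * (Ra * ∫ x in cell Lx Ly, u 2 x * T x))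
      ≤ 1 / 2 * ∫ x in cell Lx Ly, u 2 x * T x := by
    have : 32 / ((m : ℝ) + 1) * (4 / (m + 1) * (Ra * ∫ x in cell Lx Ly, u 2 x * T x))
        = 128 * Ra / (m + 1) ^ 2 * ∫ x in cell Lx Ly, u 2 x * T x := by
      field_simp
      ring
    rw [this]
    refine mul_le_mul_of_nonneg_right ?_ hB
    rw [div_le_iff₀ (by positivity)]
    linarith
  have k4 : ∀ X : ℝ, ((m : ℝ) + 1) / 8 * (4 / (m + 1) * X) = 1 / 2 * X := fun X => by
    field_simp
    ring
  rw [k4] at k1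
  linarith

/-- The heat flux is controlled in mean by the two dissipative quantities. -/
theorem integral_abs_flux_le (h : Snapshot Lx Ly Ra T u p D) (hLx : 0 < Lx) (hLy : 0 < Ly)
    (hRa : 0 < Ra) :
    ∫ x in cell Lx Ly, |u 2 x * T x - pd 2 T x|
      ≤ (4 * Ra + 9) * ((1 / 2) * (∫ x in cell Lx Ly, u 2 x * T x)
          + ∫ x in cell Lx Ly, pd 2 T x ^ 2) + 10 * (Lx * Ly) := by
  have hT := h.temp_one
  have hφ : ContDiffOn ℝ 1 (fun y : Space => 1 - y 2) slab :=
    height_contDiffOn (g := fun z => 1 - z) (by fun_prop)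
  have hTc := h.temp_continuousOn
  have huc := h.vel_continuousOn
  have hpc : ∀ j, ContinuousOn (pd j T) slab := fun j => pd_continuousOn hT j
  have hB := h.integral_buoyancy_nonneg hLx hLy hRa
  have hE := h.integral_pd_vel_sq_le hLx hLy
  have hθ := poincare_vertical hLx hLy (hT.sub hφ)
    (h.temp_periodic.sub (height_periodic Lx Ly fun z => 1 - z)) (fun x hx => by
      rcases hx with hx | hx
      · simp [hx, h.temp_bottom x hx]
      · simp [hx, h.temp_top x hx])
  have hu := poincare_vertical hLx hLy (h.vel_one 2) (h.vel_periodic 2) (h.no_slip 2)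
  have hθ' : ∫ x in cell Lx Ly, pd 2 (fun y => T y - (1 - y 2)) x ^ 2
      ≤ ∫ x in cell Lx Ly, (2 * pd 2 T x ^ 2 + 2) := by
    refine cell_integral_mono ((pd_continuousOn (hT.sub hφ) 2).pow 2) (by fun_prop) fun x hx => ?_
    rw [pd_sub hT hφ 2 hx, pd_height (g := fun z => 1 - z) 2 hx
      ((hasDerivAt_id (x 2)).const_sub 1), Pi.single_eq_same]
    nlinarith only [sq_nonneg (pd 2 T x - 1)]
  rw [cell_integral_add (by fun_prop) (by fun_prop), integral_const_mul,
    cell_integral_const hLx hLy] at hθ'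
  -- With θ = T - (1 - z): |u^z T| ≤ (u^z)²/2 + T²/2, T² ≤ 2θ² + 2, and |∂_z T| ≤ ((∂_z T)² + 1)/2.
  have hle : ∫ x in cell Lx Ly, |u 2 x * T x - pd 2 T x|
      ≤ ∫ x in cell Lx Ly, (1 / 2 * u 2 x ^ 2 + (T x - (1 - x 2)) ^ 2
        + 1 / 2 * pd 2 T x ^ 2 + 3 / 2) := by
    refine cell_integral_mono (by fun_prop) (by fun_prop) fun x hx => ?_
    have hr0 : 0 ≤ 1 - x 2 := sub_nonneg.2 hx.2
    have hr1 : 1 - x 2 ≤ 1 := sub_le_self _ hx.1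
    have hr2 : (1 - x 2) ^ 2 ≤ 1 := pow_le_one₀ hr0 hr1
    rw [abs_le]
    constructor <;>
    nlinarith only [sq_nonneg (u 2 x - T x), sq_nonneg (u 2 x + T x), sq_nonneg (pd 2 T x - 1),
      sq_nonneg (pd 2 T x + 1), sq_nonneg (T x - (1 - x 2) - (1 - x 2)), hr2]
  rw [cell_integral_add (by fun_prop) (by fun_prop), cell_integral_add (by fun_prop) (by fun_prop),
    cell_integral_add (by fun_prop) (by fun_prop), integral_const_mul, integral_const_mul,
    cell_integral_const hLx hLy] at hle
  have hS : 0 ≤ ∫ x in cell Lx Ly, pd 2 T x ^ 2 := integral_nonneg fun x => sq_nonneg _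
  nlinarith [mul_nonneg hRa.le hS, mul_nonneg hRa.le hB, mul_pos hLx hLy]

/-- Only the convective part and the constant conductive part contribute to the mean flux. -/
lemma integral_flux_eq (h : Snapshot Lx Ly Ra T u p D) (hLx : 0 < Lx) (hLy : 0 < Ly) :
    ∫ x in cell Lx Ly, (u 2 x * T x - pd 2 T x)
      = (∫ x in cell Lx Ly, u 2 x * T x) + Lx * Ly := by
  rw [cell_integral_sub ((h.vel_continuousOn 2).fun_mul h.temp_continuousOn)
    (pd_continuousOn h.temp_one 2), h.integral_pd_temp hLx hLy, sub_neg_eq_add]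

end Snapshot

/-- Every solution gives a snapshot at every positive time. -/
lemma IsNoSlipSolution.snapshot {Lx Ly Ra : ℝ} {T : ℝ → Space → ℝ} {u : ℝ → Space → Fin 3 → ℝ}
    {p : ℝ → Space → ℝ} (h : IsNoSlipSolution Lx Ly Ra T u p) {t : ℝ} (ht : 0 < t) :
    Snapshot Lx Ly Ra (T t) (fun i x => u t x i) (p t) (fun x => deriv (fun s => T s x) t) where
  temp := h.temp_spatialC2.contDiffOn t ht
  vel i := (h.vel_spatialC2 i).contDiffOn t ht
  pressure := h.pressure_contDiffOn t ht
  deriv_continuousOn := h.temp_timeC1.continuousOn_deriv.comp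
    (f := fun x : Space => (t, x)) (by fun_prop) fun _ hx => ⟨ht, hx⟩
  temp_periodic := h.temp_periodic t ht
  vel_periodic i x := ⟨congrFun (h.vel_periodic t ht x).1 i, congrFun (h.vel_periodic t ht x).2 i⟩
  pressure_periodic := h.pressure_periodic t ht
  heat := h.heat t ht
  incompressible := h.incompressible t ht
  stokes := h.stokes t ht
  no_slip i x hx := by rw [h.no_slip t ht x hx]; rfl
  temp_bottom := h.temp_bottom t ht
  temp_top := h.temp_top t ht

/-! ### Integrals over the cell depending on time -/

section Parametric

variable {Q Q' : ℝ → Space → ℝ}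

lemma exists_cell_bound (hQ : ContinuousOn (fun q : ℝ × Space => Q q.1 q.2) (Ioi 0 ×ˢ slab))
    (Lx Ly : ℝ) {t : ℝ} (ht : 0 < t) :
    ∃ C, ∀ s ∈ Icc (t / 2) (2 * t), ∀ x ∈ cell Lx Ly, ‖Q s x‖ ≤ C := by
  obtain ⟨C, hC⟩ := (isCompact_Icc.prod (isCompact_cell Lx Ly)).exists_bound_of_continuousOn
    (hQ.mono (prod_mono (s₁ := Icc (t / 2) (2 * t))
      (fun s hs => lt_of_lt_of_le (half_pos ht) hs.1) (cell_subset_slab Lx Ly)))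
  exact ⟨C, fun s hs x hx => hC (s, x) ⟨hs, hx⟩⟩

lemma continuousOn_slice (hQ : ContinuousOn (fun q : ℝ × Space => Q q.1 q.2) (Ioi 0 ×ˢ slab))
    {t : ℝ} (ht : 0 < t) : ContinuousOn (Q t) slab :=
  hQ.comp (f := fun x : Space => (t, x)) (by fun_prop) fun _ hx => ⟨ht, hx⟩

lemma Icc_half_double_mem_nhds {t : ℝ} (ht : 0 < t) : Icc (t / 2) (2 * t) ∈ 𝓝 t :=
  Icc_mem_nhds (by linarith) (by linarith)

lemma continuousOn_cell_integral
    (hQ : ContinuousOn (fun q : ℝ × Space => Q q.1 q.2) (Ioi 0 ×ˢ slab)) (Lx Ly : ℝ) :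
    ContinuousOn (fun t => ∫ x in cell Lx Ly, Q t x) (Ioi 0) := by
  intro t ht
  obtain ⟨C, hC⟩ := exists_cell_bound hQ Lx Ly ht
  refine (continuousAt_of_dominated (bound := fun _ => C) ?_ ?_
    (integrableOn_cell continuousOn_const Lx Ly) ?_).continuousWithinAt
  · filter_upwards [Ioi_mem_nhds ht] with s hs
    exact (integrableOn_cell (continuousOn_slice hQ hs) Lx Ly).aestronglyMeasurable
  · filter_upwards [Icc_half_double_mem_nhds ht] with s hs
    exact (ae_restrict_iff' (measurableSet_cell Lx Ly)).2 (ae_of_all _ (hC s hs))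
  · refine (ae_restrict_iff' (measurableSet_cell Lx Ly)).2 (ae_of_all _ fun x hx => ?_)
    exact (hQ.comp (f := fun s : ℝ => (s, x)) (by fun_prop)
      fun s hs => ⟨hs, cell_subset_slab Lx Ly hx⟩).continuousAt (Ioi_mem_nhds ht)

lemma hasDerivAt_cell_integral
    (hQ : ContinuousOn (fun q : ℝ × Space => Q q.1 q.2) (Ioi 0 ×ˢ slab))
    (hQ' : ContinuousOn (fun q : ℝ × Space => Q' q.1 q.2) (Ioi 0 ×ˢ slab))
    (hd : ∀ t, 0 < t → ∀ x ∈ slab, HasDerivAt (fun s => Q s x) (Q' t x) t)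
    (Lx Ly : ℝ) {t : ℝ} (ht : 0 < t) :
    HasDerivAt (fun t => ∫ x in cell Lx Ly, Q t x) (∫ x in cell Lx Ly, Q' t x) t := by
  obtain ⟨C, hC⟩ := exists_cell_bound hQ' Lx Ly ht
  refine (hasDerivAt_integral_of_dominated_loc_of_deriv_le (bound := fun _ => C)
    (Icc_half_double_mem_nhds ht) ?_ (integrableOn_cell (continuousOn_slice hQ ht) Lx Ly)
    (integrableOn_cell (continuousOn_slice hQ' ht) Lx Ly).aestronglyMeasurable ?_
    (integrableOn_cell continuousOn_const Lx Ly) ?_).2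
  · filter_upwards [Ioi_mem_nhds ht] with s hs
    exact (integrableOn_cell (continuousOn_slice hQ hs) Lx Ly).aestronglyMeasurable
  · exact (ae_restrict_iff' (measurableSet_cell Lx Ly)).2
      (ae_of_all _ fun x hx s hs => hC s hs x hx)
  · exact (ae_restrict_iff' (measurableSet_cell Lx Ly)).2 (ae_of_all _ fun x hx s hs =>
      hd s (lt_of_lt_of_le (half_pos ht) hs.1) x (cell_subset_slab Lx Ly hx))

end Parametric

/-! ### The energy argument -/

/-- The dissipation controlling the heat flux at time `t`. -/
noncomputable def dissipation (Lx Ly : ℝ) (T : ℝ → Space → ℝ) (u : ℝ → Space → Fin 3 → ℝ) (t : ℝ) : ℝ :=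
  (1 / 2) * (∫ x in cell Lx Ly, u t x 2 * T t x) + ∫ x in cell Lx Ly, pd 2 (T t) x ^ 2

/-- The modified thermal energy attached to the test profile. -/
noncomputable def energy (Lx Ly : ℝ) (T : ℝ → Space → ℝ) (m : ℕ) (t : ℝ) : ℝ :=
  ∫ x in cell Lx Ly, (3 / 2 * T t x ^ 2 - testProfile m (x 2) * T t x)

/-- Continuity says nothing at time 0. By nonnegativity the integrals over [a, b] are L¹ norms, so
their uniform bound yields integrability down to 0 and passes to the limit a → 0⁺. -/
lemma setIntegral_le_of_forall_lower {S : ℝ → ℝ} {K b : ℝ} (hS : ContinuousOn S (Ioi 0))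
    (hpos : ∀ t, 0 < t → 0 ≤ S t) (hb : 0 < b)
    (hK : ∀ᶠ a in 𝓝[>] (0 : ℝ), ∫ s in a..b, S s ≤ K) :
    IntervalIntegrable S volume 0 b ∧ ∫ s in (0 : ℝ)..b, S s ≤ K := by
  have hlt : ∀ᶠ a in 𝓝[>] (0 : ℝ), a < b := nhdsWithin_le_nhds (Iio_mem_nhds hb)
  have hseq : Tendsto (fun n : ℕ => 1 / ((n : ℝ) + 1)) atTop (𝓝[>] 0) :=
    tendsto_nhdsWithin_iff.2 ⟨tendsto_one_div_add_atTop_nhds_zero_nat,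
      Eventually.of_forall fun n => by simp only [mem_Ioi]; positivity⟩
  have hint : IntegrableOn S (Ioc 0 b) := by
    refine integrableOn_Ioc_of_intervalIntegral_norm_bounded_left (I := K)
      (a := fun n : ℕ => 1 / ((n : ℝ) + 1)) (fun n => ?_) (hseq.mono_right nhdsWithin_le_nhds) ?_
    · refine ((hS.mono fun s hs => ?_).integrableOn_Icc).mono_set Ioc_subset_Icc_self
      exact lt_of_lt_of_le (by positivity) hs.1
    · filter_upwards [hseq.eventually hK, hseq.eventually hlt] with n hn hnb
      rw [intervalIntegral.integral_of_le hnb.le] at hn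
      refine (setIntegral_congr_fun measurableSet_Ioc fun s hs => ?_).trans_le hn
      exact Real.norm_of_nonneg (hpos s (lt_trans (by positivity) hs.1))
  have hii : IntervalIntegrable S volume 0 b :=
    (intervalIntegrable_iff_integrableOn_Ioc_of_le hb.le).2 hint
  refine ⟨hii, ?_⟩
  have hc := intervalIntegral.continuousOn_primitive_interval' hii right_mem_uIcc 0 left_mem_uIcc
  have ht : Tendsto (fun a => ∫ s in a..b, S s) (𝓝[>] 0) (𝓝 (∫ s in (0 : ℝ)..b, S s)) := by
    have h1 := (hc.tendsto.mono_left
      (nhdsWithin_le_of_mem (uIcc_of_le hb.le ▸ Icc_mem_nhdsGT hb))).neg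
    simpa only [← intervalIntegral.integral_symm] using h1
  exact le_of_tendsto ht hK

/-! ### Integration in time and the Nusselt bound -/

section Solution

variable {Lx Ly Ra : ℝ} {T : ℝ → Space → ℝ} {u : ℝ → Space → Fin 3 → ℝ} {p : ℝ → Space → ℝ}

namespace IsNoSlipSolution

lemma continuousOn_dissipation (h : IsNoSlipSolution Lx Ly Ra T u p) :
    ContinuousOn (dissipation Lx Ly T u) (Ioi 0) := by
  have h1 := continuousOn_cell_integral (Q := fun t x => u t x 2 * T t x)
    ((h.vel_spatialC2 2).continuousOn.fun_mul h.temp_spatialC2.continuousOn) Lx Ly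
  have h2 := continuousOn_cell_integral (Q := fun t x => pd 2 (T t) x ^ 2)
    ((h.temp_spatialC2.continuousOn_pd 2).pow 2) Lx Ly
  unfold dissipation
  fun_prop

lemma dissipation_nonneg (h : IsNoSlipSolution Lx Ly Ra T u p) (hLx : 0 < Lx) (hLy : 0 < Ly)
    (hRa : 0 < Ra) {t : ℝ} (ht : 0 < t) : 0 ≤ dissipation Lx Ly T u t := by
  have h1 := (h.snapshot ht).integral_buoyancy_nonneg hLx hLy hRa
  have h2 : 0 ≤ ∫ x in cell Lx Ly, pd 2 (T t) x ^ 2 := integral_nonneg fun x => sq_nonneg _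
  unfold dissipation
  linarith

/-- The temperature stays bounded in `L²` near the initial time. -/
lemma eventually_integral_temp_sq_le (h : IsNoSlipSolution Lx Ly Ra T u p) :
    ∃ M : ℝ, ∀ᶠ t in 𝓝[>] (0 : ℝ), ∫ x in cell Lx Ly, T t x ^ 2 ≤ M := by
  set μ := volume.restrict (cell Lx Ly)
  have h0 := h.initial_memLp
  set K := 1 + eLpNorm (T 0) 2 μ with hK
  have hKt : K ≠ ⊤ := ENNReal.add_ne_top.2 ⟨ENNReal.one_ne_top, h0.eLpNorm_ne_top⟩
  refine ⟨K.toReal ^ 2, ?_⟩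
  -- The initial condition enters the argument only in this lemma, through the triangle inequality
  -- in L².
  filter_upwards [h.initial_tendsto.eventually (gt_mem_nhds (zero_lt_one : (0 : ENNReal) < 1)),
    self_mem_nhdsWithin] with t ht1 ht
  have hc : ContinuousOn (T t) slab := (h.snapshot ht).temp_continuousOn
  have hm : AEStronglyMeasurable (T t) μ := (integrableOn_cell hc Lx Ly).aestronglyMeasurable
  have hle : eLpNorm (T t) 2 μ ≤ K := by
    have := eLpNorm_add_le (p := 2) (hm.sub h0.aestronglyMeasurable) h0.aestronglyMeasurable
      (by norm_num)
    rw [sub_add_cancel] at this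
    exact this.trans (add_le_add ht1.le le_rfl)
  have hmem : MemLp (T t) 2 μ := ⟨hm, hle.trans_lt hKt.lt_top⟩
  rw [hmem.eLpNorm_eq_integral_rpow_norm (by norm_num) (by norm_num)] at hle
  have hn : 0 ≤ ∫ x, T t x ^ 2 ∂μ := integral_nonneg fun x => sq_nonneg _
  simp only [ENNReal.toReal_ofNat, Real.rpow_two, Real.norm_eq_abs, sq_abs] at hle
  rw [ENNReal.ofReal_le_iff_le_toReal hKt, ← one_div, ← Real.sqrt_eq_rpow] at hle
  exact (Real.sqrt_le_left ENNReal.toReal_nonneg).1 hle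

/-- Completing the square gives the pointwise lower bound -ψ²/6 ≥ -16/6 > -3, uniformly in `m`. -/
lemma energy_lower (h : IsNoSlipSolution Lx Ly Ra T u p) (hLx : 0 < Lx) (hLy : 0 < Ly) (m : ℕ)
    {t : ℝ} (ht : 0 < t) : -3 * (Lx * Ly) ≤ energy Lx Ly T m t := by
  have hc : ContinuousOn (T t) slab := (h.snapshot ht).temp_continuousOn
  have hψ := (height_contDiffOn (contDiff_testProfile m)).continuousOn
  have := cell_integral_mono (Lx := Lx) (Ly := Ly) (f := fun _ => -3)
    (g := fun x => 3 / 2 * T t x ^ 2 - testProfile m (x 2) * T t x)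
    continuousOn_const (by fun_prop) fun x hx => by
      nlinarith only [testProfile_sq_le m hx, sq_nonneg (3 * T t x - testProfile m (x 2))]
  rw [cell_integral_const hLx hLy] at this
  unfold energy
  linarith

lemma energy_upper (h : IsNoSlipSolution Lx Ly Ra T u p) (hLx : 0 < Lx) (hLy : 0 < Ly) (m : ℕ)
    {t : ℝ} (ht : 0 < t) :
    energy Lx Ly T m t ≤ 2 * (∫ x in cell Lx Ly, T t x ^ 2) + 8 * (Lx * Ly) := by
  have hc : ContinuousOn (T t) slab := (h.snapshot ht).temp_continuousOn
  have hψ := (height_contDiffOn (contDiff_testProfile m)).continuousOn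
  have := cell_integral_mono (Lx := Lx) (Ly := Ly)
    (f := fun x => 3 / 2 * T t x ^ 2 - testProfile m (x 2) * T t x)
    (g := fun x => 2 * T t x ^ 2 + 8) (by fun_prop) (by fun_prop) fun x hx => by
      nlinarith only [testProfile_sq_le m hx, sq_nonneg (T t x + testProfile m (x 2))]
  rw [cell_integral_add (by fun_prop) (by fun_prop), cell_integral_const hLx hLy,
    integral_const_mul] at this
  unfold energy
  linarith

lemma integral_dissipation_le (h : IsNoSlipSolution Lx Ly Ra T u p) (hLx : 0 < Lx) (hLy : 0 < Ly)
    (hRa : 0 < Ra) {m : ℕ} (hm : 256 * Ra ≤ ((m : ℝ) + 1) ^ 2) {a b : ℝ} (ha : 0 < a)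
    (hab : a ≤ b) :
    ∫ s in a..b, dissipation Lx Ly T u s
      ≤ energy Lx Ly T m a - energy Lx Ly T m b + 5 * (m + 1) * (Lx * Ly) * (b - a) := by
  have hTc := h.temp_spatialC2.continuousOn
  have hDc := h.temp_timeC1.continuousOn_deriv
  have hψ : Continuous (testProfile m) := (contDiff_testProfile m).continuous
  have hQ' : ContinuousOn (fun q : ℝ × Space => (3 * T q.1 q.2 - testProfile m (q.2 2)) *
      deriv (fun s => T s q.2) q.1) (Ioi 0 ×ˢ slab) := by fun_prop
  have hE : ∀ t, 0 < t → HasDerivAt (energy Lx Ly T m)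
      (∫ x in cell Lx Ly, (3 * T t x - testProfile m (x 2)) * deriv (fun s => T s x) t) t :=
    fun t ht => hasDerivAt_cell_integral
      (Q := fun t x => 3 / 2 * T t x ^ 2 - testProfile m (x 2) * T t x)
      (Q' := fun t x => (3 * T t x - testProfile m (x 2)) * deriv (fun s => T s x) t)
      (by fun_prop) hQ' (fun s hs x hx => by
        have hd := (h.temp_timeC1.differentiableAt s hs x hx).hasDerivAt
        refine (((hd.fun_pow 2).const_mul (3 / 2)).fun_sub
          (hd.const_mul (testProfile m (x 2)))).congr_deriv ?_
        push_cast
        ring) Lx Ly ht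
  have hsub : Icc a b ⊆ Ioi 0 := fun s hs => lt_of_lt_of_le ha hs.1
  have hE'i : IntervalIntegrable (fun t => ∫ x in cell Lx Ly,
      (3 * T t x - testProfile m (x 2)) * deriv (fun s => T s x) t) volume a b :=
    ((continuousOn_cell_integral hQ' Lx Ly).mono hsub).intervalIntegrable_of_Icc hab
  have hSi : IntervalIntegrable (dissipation Lx Ly T u) volume a b :=
    (h.continuousOn_dissipation.mono hsub).intervalIntegrable_of_Icc hab
  have hftc := intervalIntegral.integral_eq_sub_of_hasDerivAt
    (fun s hs => hE s (hsub (by rwa [uIcc_of_le hab] at hs))) hE'i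
  have hmono := intervalIntegral.integral_mono_on hab (hE'i.add hSi)
    (intervalIntegrable_const (c := 5 * ((m : ℝ) + 1) * (Lx * Ly)))
    (fun s hs => (h.snapshot (hsub hs)).integral_test_le hLx hLy hm hRa)
  rw [intervalIntegral.integral_const, smul_eq_mul] at hmono
  have hadd := intervalIntegral.integral_add hE'i hSi
  rw [hadd, hftc] at hmono
  linarith

/-- The time integral of the dissipation grows at most linearly, with a rate which is the
reciprocal width of the boundary layer of the test profile. -/
theorem exists_integral_dissipation_le (h : IsNoSlipSolution Lx Ly Ra T u p) (hLx : 0 < Lx)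
    (hLy : 0 < Ly) (hRa : 0 < Ra) {m : ℕ} (hm : 256 * Ra ≤ ((m : ℝ) + 1) ^ 2) :
    ∃ K : ℝ, ∀ b, 0 < b → IntervalIntegrable (dissipation Lx Ly T u) volume 0 b ∧
      ∫ s in (0 : ℝ)..b, dissipation Lx Ly T u s ≤ K + 5 * (m + 1) * (Lx * Ly) * b := by
  obtain ⟨M, hM⟩ := h.eventually_integral_temp_sq_le
  refine ⟨2 * M + 11 * (Lx * Ly), fun b hb => ?_⟩
  refine setIntegral_le_of_forall_lower h.continuousOn_dissipation
    (fun t ht => h.dissipation_nonneg hLx hLy hRa ht) hb ?_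
  filter_upwards [hM, self_mem_nhdsWithin, nhdsWithin_le_nhds (Iio_mem_nhds hb)] with a hMa ha hab
  have ha' : (0 : ℝ) < a := ha
  have h1 := h.integral_dissipation_le hLx hLy hRa hm ha (le_of_lt hab)
  have h2 := h.energy_lower hLx hLy m hb
  have h3 := h.energy_upper hLx hLy m ha
  have h4 : 0 ≤ 5 * ((m : ℝ) + 1) * (Lx * Ly) * a := by positivity
  linarith

/-- The vertical heat flux is integrable up to the initial time. -/
theorem integrableOn_heatFlux (h : IsNoSlipSolution Lx Ly Ra T u p) (hLx : 0 < Lx) (hLy : 0 < Ly)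
    (hRa : 0 < Ra) {t : ℝ} (ht : 0 < t) :
    IntegrableOn (fun q : ℝ × Space => heatFlux T u q.1 q.2) (Ioc 0 t ×ˢ cell Lx Ly) := by
  -- Only finiteness matters here, so any admissible `m` will do.
  obtain ⟨m, hm⟩ := exists_nat_ge (256 * Ra)
  obtain ⟨K, hK⟩ := h.exists_integral_dissipation_le hLx hLy hRa (m := m)
    (by nlinarith [(Nat.cast_nonneg m : (0 : ℝ) ≤ m)])
  have hflux : ContinuousOn (fun q : ℝ × Space => heatFlux T u q.1 q.2) (Ioi 0 ×ˢ slab) :=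
    ((h.vel_spatialC2 2).continuousOn.mul h.temp_spatialC2.continuousOn).sub
      (h.temp_spatialC2.continuousOn_pd 2)
  have habs := continuousOn_cell_integral (Q := fun s x => ‖heatFlux T u s x‖) hflux.norm Lx Ly
  have hmeas := (hflux.mono (prod_mono Ioc_subset_Ioi_self (cell_subset_slab Lx Ly))).aestronglyMeasurable
    (μ := volume) ((measurableSet_Ioc (a := (0 : ℝ)) (b := t)).prod (measurableSet_cell Lx Ly))
  rw [IntegrableOn]
  rw [Measure.volume_eq_prod, ← Measure.prod_restrict] at hmeas ⊢
  refine (integrable_prod_iff hmeas).2 ⟨?_, ?_⟩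
  · exact (ae_restrict_iff' measurableSet_Ioc).2
      (ae_of_all _ fun s hs => integrableOn_cell (continuousOn_slice hflux hs.1) Lx Ly)
  · have hS := (intervalIntegrable_iff_integrableOn_Ioc_of_le ht.le).1 (hK t ht).1
    have hb : IntegrableOn (fun s => (4 * Ra + 9) * dissipation Lx Ly T u s + 10 * (Lx * Ly))
        (Ioc 0 t) := (hS.const_mul _).add (integrableOn_const (by simp))
    refine Integrable.mono' hb
      ((habs.mono Ioc_subset_Ioi_self).aestronglyMeasurable measurableSet_Ioc) ?_
    refine (ae_restrict_iff' measurableSet_Ioc).2 (ae_of_all _ fun s hs => ?_)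
    rw [Real.norm_of_nonneg (integral_nonneg fun x => norm_nonneg _)]
    exact (h.snapshot hs.1).integral_abs_flux_le hLx hLy hRa

/-- The flux integrates to B + A ≤ 2 (B/2 + S) + A, so the rate 5(m+1) doubles to 10(m+1), and the
initial energy survives only in the transient K/t. -/
theorem exists_meanHeatFlux_le (h : IsNoSlipSolution Lx Ly Ra T u p) (hLx : 0 < Lx) (hLy : 0 < Ly)
    (hRa : 0 < Ra) {m : ℕ} (hm : 256 * Ra ≤ ((m : ℝ) + 1) ^ 2) :
    ∃ K : ℝ, ∀ t, 0 < t → meanHeatFlux Lx Ly T u t ≤ 1 + 10 * (m + 1) + K / t := by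
  obtain ⟨K, hK⟩ := h.exists_integral_dissipation_le hLx hLy hRa hm
  have hA : 0 < Lx * Ly := by positivity
  refine ⟨2 / (Lx * Ly) * K, fun t ht => ?_⟩
  obtain ⟨hi, hle⟩ := hK t ht
  have hflux := h.integrableOn_heatFlux hLx hLy hRa ht
  rw [IntegrableOn, Measure.volume_eq_prod, ← Measure.prod_restrict] at hflux
  have hfi : IntervalIntegrable (fun s => 1 / (Lx * Ly) * ∫ x in cell Lx Ly, heatFlux T u s x)
      volume 0 t :=
    ((intervalIntegrable_iff_integrableOn_Ioc_of_le ht.le).2 hflux.integral_prod_left).const_mul _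
  have hmono := intervalIntegral.integral_mono_on_of_le_Ioo ht.le hfi
    ((hi.const_mul (2 / (Lx * Ly))).add (intervalIntegrable_const (c := (1 : ℝ)))) fun s hs => by
      have h1 := (h.snapshot hs.1).integral_flux_eq hLx hLy
      have h2 : 0 ≤ ∫ x in cell Lx Ly, pd 2 (T s) x ^ 2 := integral_nonneg fun x => sq_nonneg _
      have h3 : ∫ x in cell Lx Ly, heatFlux T u s x
          = (∫ x in cell Lx Ly, u s x 2 * T s x) + Lx * Ly := h1
      rw [h3, dissipation, div_mul_eq_mul_div, div_mul_eq_mul_div, ← sub_nonneg]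
      have : 2 * (1 / 2 * (∫ x in cell Lx Ly, u s x 2 * T s x)
          + ∫ x in cell Lx Ly, pd 2 (T s) x ^ 2) / (Lx * Ly) + 1
          - 1 * ((∫ x in cell Lx Ly, u s x 2 * T s x) + Lx * Ly) / (Lx * Ly)
          = 2 * (∫ x in cell Lx Ly, pd 2 (T s) x ^ 2) / (Lx * Ly) := by
        field_simp
        ring
      rw [this]
      positivity
  rw [intervalIntegral.integral_add (hi.const_mul _) intervalIntegrable_const,
    intervalIntegral.integral_const_mul (2 / (Lx * Ly)), intervalIntegral.integral_const] at hmono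
  have hfin := hmono.trans (add_le_add_left (mul_le_mul_of_nonneg_left hle
    (by positivity : 0 ≤ 2 / (Lx * Ly))) _)
  rw [meanHeatFlux]
  refine (mul_le_mul_of_nonneg_left hfin (by positivity)).trans_eq ?_
  field_simp
  simp
  ring

theorem nusselt_le (h : IsNoSlipSolution Lx Ly Ra T u p) (hLx : 0 < Lx) (hLy : 0 < Ly)
    (hRa : 1 ≤ Ra) : nusselt Lx Ly T u ≤ ((181 * Ra ^ (1 / 2 : ℝ) : ℝ) : EReal) := by
  rw [← Real.sqrt_eq_rpow]
  have hs1 : 1 ≤ √Ra := Real.one_le_sqrt.2 hRa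
  have hs2 : √Ra ^ 2 = Ra := Real.sq_sqrt (zero_le_one.trans hRa)
  -- The choice m = ⌈16√Ra⌉ gives (m+1)² ≥ 256 Ra and m + 1 < 16√Ra + 2. Hence 1 + 10(m+1) ≤ 160√Ra
  -- + 21 ≤ 181√Ra, using Ra ≥ 1.
  have hm1 := Nat.le_ceil (16 * √Ra)
  have hm2 := Nat.ceil_lt_add_one (by positivity : 0 ≤ 16 * √Ra)
  obtain ⟨K, hK⟩ := h.exists_meanHeatFlux_le hLx hLy (zero_lt_one.trans_le hRa)
    (m := ⌈16 * √Ra⌉₊) (by nlinarith)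
  have hlim : Tendsto (fun t : ℝ => 1 + 10 * ((⌈16 * √Ra⌉₊ : ℝ) + 1) + K / t) atTop
      (𝓝 (1 + 10 * ((⌈16 * √Ra⌉₊ : ℝ) + 1) + 0)) :=
    tendsto_const_nhds.add (tendsto_const_nhds.div_atTop tendsto_id)
  have hlim' := (continuous_coe_real_ereal.tendsto _).comp hlim
  have hle : nusselt Lx Ly T u ≤ limsup (fun t : ℝ =>
      ((1 + 10 * ((⌈16 * √Ra⌉₊ : ℝ) + 1) + K / t : ℝ) : EReal)) atTop :=
    limsup_le_limsup ((eventually_gt_atTop 0).mono fun t ht => EReal.coe_le_coe_iff.2 (hK t ht))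
  refine hle.trans (hlim'.limsup_eq.trans_le (EReal.coe_le_coe_iff.2 ?_))
  linarith

end IsNoSlipSolution

end Solution

end RayleighBenard

theorem mainTheorem1 :
    ∃ C : ℝ, 0 < C ∧
      ∀ Lx Ly Ra : ℝ, 0 < Lx → 0 < Ly → 1 ≤ Ra →
      ∀ (T : ℝ → RayleighBenard.Space → ℝ) (u : ℝ → RayleighBenard.Space → Fin 3 → ℝ)
        (p : ℝ → RayleighBenard.Space → ℝ),
        RayleighBenard.IsNoSlipSolution Lx Ly Ra T u p →
        (∀ t : ℝ, 0 < t →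
          IntegrableOn (fun q : ℝ × RayleighBenard.Space => RayleighBenard.heatFlux T u q.1 q.2)
            (Ioc 0 t ×ˢ RayleighBenard.cell Lx Ly)) ∧
        RayleighBenard.nusselt Lx Ly T u ≤ ((C * Ra ^ (1 / 2 : ℝ) : ℝ) : EReal) :=
  ⟨181, by norm_num, fun _ _ _ hLx hLy hRa _ _ _ h =>
    ⟨fun _ ht => h.integrableOn_heatFlux hLx hLy (zero_lt_one.trans_le hRa) ht,
      h.nusselt_le hLx hLy hRa⟩⟩
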